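/- Let $(X,d,\mathfrak m)$ be a complete, separable metric space with a non-trivial Borel measure $\mathfrak m$ that is finite on bounded sets and doubling, i.e. there is $C_D\ge 1$ with $\mathfrak m(B_{2r}(z))\le C_D\,\mathfrak m(B_r(z))$ for all $z\in X$, $r>0$ (all balls are open). Let $p\in[1,\infty)$, $L\ge 1$ and $x,y\in X$. Let $\mathfrak m_{x,y}^L:=R_{x,y}^L\,\mathfrak m$, where $$R_{x,y}^L(z):=\left(\frac{d(x,z)}{\mathfrak m(B_{d(x,z)}(x))}+\frac{d(y,z)}{\mathfrak m(B_{d(y,z)}(y))}\right)\chi_{B_{L d(x,y)}(x)\cup B_{L d(x,y)}(y)}(z)\quad (z\ne x,y),\qquad R_{x,y}^L(x)=R_{x,y}^L(y)=0.$$ Let $\Gamma_{x,y}$ be the family of rectifiable curves $\gamma\colon[a,b]\to X$, $a<b$, with $\gamma(a)=x$ and $\gamma(b)=y$, let $\int_\gamma\rho$ be the integral of $\rho$ along $\gamma$ with respect to arc-length, and set $$\mathrm{Mod}_p(\Gamma_{x,y},\mathfrak m_{x,y}^L):=\inf\left\{\int\rho^p\,d\mathfrak m_{x,y}^L : \rho\colon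 X\to[0,+\infty]\text{ Borel},\ \int_\gamma\rho\ge 1\text{ for all }\gamma\in\Gamma_{x,y}\right\}.$$ A chain from $x$ to $y$ is a finite sequence $\mathsf c=(q_0,\dots,q_N)$, $N\ge 0$, of points of $X$ with $q_0=x$ and $q_N=y$; it is an $\varepsilon$-chain if $d(q_i,q_{i+1})\le\varepsilon$ for all $0\le i<N$. For $g\colon X\to[0,+\infty]$ put $\int_{\mathsf c}g:=\sum_{i=0}^{N-1}\frac{g(q_i)+g(q_{i+1})}{2}\,d(q_i,q_{i+1})$ (with $\infty\cdot 0=0$). For $\varepsilon>0$ and a class $\mathcal F$ of Borel functions on $X$ let $$\mathrm{ChMod}^{\varepsilon}_{p}(\mathcal F):=\inf\left\{\int\rho^p\,d\mathfrak m_{x,y}^L : \rho\in\mathcal F,\ \rho\ge 0\text{ Borel},\ \int_{\mathsf c}\rho\ge 1\text{ for every }\varepsilon\text{-chain }\mathsf c\text{ from }x\text{ to }y\right\}.$$ Let $\mathcal F_{x,y}$ be the class of Borel functions $g\colon X\to[0,+\infty]$ with $g(x)<+\infty$ and $g(y)<+\infty$, and let $\mathrm{Lip}(X)$ be the class of real-valued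 Lipschitz functions on $X$. Infima over the empty set are $+\infty$. Then both limits below exist in $[0,+\infty]$ and $$\mathrm{Mod}_p(\Gamma_{x,y},\mathfrak m_{x,y}^L)=\lim_{\varepsilon\to 0^+}\mathrm{ChMod}^{\varepsilon}_{p}(\mathcal F_{x,y})=\lim_{\varepsilon\to 0^+}\mathrm{ChMod}^{\varepsilon}_{p}(\mathrm{Lip}(X)).$$ -/

import Mathlib

open MeasureTheory Set Filter Topology
open scoped ENNReal NNReal

noncomputable section

namespace ChainModulus

/-! ### Metric measure spaces -/

/-- The conditions on the measure of a metric measure space: a non-trivial Borel measure which is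
finite on bounded sets. -/
structure IsMetricMeasure {X : Type*} [MetricSpace X] [MeasurableSpace X]
    (m : Measure X) : Prop where
  nontrivial : m ≠ 0
  finite_of_bounded : ∀ s : Set X, Bornology.IsBounded s → m s < ∞

/-- `m` is doubling: there is `C ≥ 1` with `m (B_{2r}(x)) ≤ C m (B_r(x))` for all `x` and all
`r > 0`. -/
def IsDoubling {X : Type*} [MetricSpace X] [MeasurableSpace X] (m : Measure X) : Prop :=
  ∃ C : ℝ≥0, 1 ≤ C ∧ ∀ (x : X) (r : ℝ), 0 < r →
    m (Metric.ball x (2 * r)) ≤ C * m (Metric.ball x r)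

/-! ### The truncated Riesz measure -/

/-- The set `B_{x,y}^L`, the union of the open balls of radius `L d(x,y)` around `x` and `y`. -/
def rieszRegion {X : Type*} [MetricSpace X] (L : ℝ) (x y : X) : Set X :=
  Metric.ball x (L * dist x y) ∪ Metric.ball y (L * dist x y)

/-- The `L`-truncated Riesz potential with poles at `x` and `y`, set to be `0` at the poles. -/
def rieszPotential {X : Type*} [MetricSpace X] [MeasurableSpace X] (m : Measure X)
    (L : ℝ) (x y : X) : X → ℝ≥0∞ :=
  (rieszRegion L x y \ {x, y}).indicator fun z =>
    ENNReal.ofReal (dist x z) / m (Metric.ball x (dist x z)) +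
      ENNReal.ofReal (dist y z) / m (Metric.ball y (dist y z))

/-- The measure `m_{x,y}^L`, with density the truncated Riesz potential with respect to `m`. -/
def rieszMeasure {X : Type*} [MetricSpace X] [MeasurableSpace X] (m : Measure X)
    (L : ℝ) (x y : X) : Measure X :=
  m.withDensity (rieszPotential m L x y)

/-! ### Curves -/

/-- A curve in `X`: a continuous map on a compact interval `[a, b]` with `a < b`. Only the values
of `toFun` on `[a, b]` matter. -/
structure Curve (X : Type*) [MetricSpace X] where
  a : ℝ
  b : ℝ
  lt : a < b
  toFun : ℝ → X
  continuousOn : ContinuousOn toFun (Icc a b)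

/-- The length of a curve. -/
def Curve.length {X : Type*} [MetricSpace X] (γ : Curve X) : ℝ≥0∞ :=
  eVariationOn γ.toFun (Icc γ.a γ.b)

/-- A curve is rectifiable if it has finite length. -/
def Curve.Rectifiable {X : Type*} [MetricSpace X] (γ : Curve X) : Prop :=
  γ.length ≠ ∞

/-- The integral of `g` over a rectifiable curve, `∫_0^{ℓ(γ)} g (γ (s_γ (t))) dt`, where
`γ ∘ s_γ` is the reparametrization by arc-length. -/
def Curve.integral {X : Type*} [MetricSpace X] (γ : Curve X) (g : X → ℝ≥0∞) : ℝ≥0∞ :=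
  ∫⁻ t in Icc (0 : ℝ) γ.length.toReal,
    g (naturalParameterization γ.toFun (Icc γ.a γ.b) γ.a t)

/-- The family `Γ_{x,y}` of rectifiable curves from `x` to `y`. -/
def curvesBetween {X : Type*} [MetricSpace X] (x y : X) : Set (Curve X) :=
  {γ | γ.Rectifiable ∧ γ.toFun γ.a = x ∧ γ.toFun γ.b = y}

/-- The functions admissible for a family of curves. -/
def curveAdm {X : Type*} [MetricSpace X] (Γ : Set (Curve X)) : Set (X → ℝ≥0∞) :=
  {ρ | ∀ γ ∈ Γ, 1 ≤ γ.integral ρ}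

/-- The `p`-modulus of a family of curves with respect to the measure `μ`: the infimum of
`∫ ρ^p dμ` over all Borel admissible `ρ`. -/
def curveModulus {X : Type*} [MetricSpace X] [MeasurableSpace X]
    (p : ℝ) (Γ : Set (Curve X)) (μ : Measure X) : ℝ≥0∞ :=
  ⨅ ρ ∈ curveAdm Γ ∩ {ρ | Measurable ρ}, ∫⁻ z, ρ z ^ p ∂μ

/-! ### Chains -/

/-- A chain in `X`: a finite sequence of points `q_0, …, q_N`. -/
structure Chain (X : Type*) where
  N : ℕ
  q : Fin (N + 1) → X

/-- The set of `ε`-chains. -/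
def epsChains (X : Type*) [MetricSpace X] (ε : ℝ) : Set (Chain X) :=
  {c | ∀ i : Fin c.N, dist (c.q i.castSucc) (c.q i.succ) ≤ ε}

/-- The integral of `g` over a chain,
`∑_{i < N} (g(q_i) + g(q_{i+1})) / 2 * d(q_i, q_{i+1})`. -/
def Chain.integral {X : Type*} [MetricSpace X] (c : Chain X) (g : X → ℝ≥0∞) : ℝ≥0∞ :=
  ∑ i : Fin c.N, (g (c.q i.castSucc) + g (c.q i.succ)) / 2 *
    ENNReal.ofReal (dist (c.q i.castSucc) (c.q i.succ))

/-- The family of all chains from `x` to `y`. -/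
def chainsBetween {X : Type*} (x y : X) : Set (Chain X) :=
  {c | c.q 0 = x ∧ c.q (Fin.last c.N) = y}

/-- The Borel functions `ρ : X → [0, ∞]` that are `ε`-admissible for a family of chains. -/
def chainAdm {X : Type*} [MetricSpace X] [MeasurableSpace X]
    (ε : ℝ) (C : Set (Chain X)) : Set (X → ℝ≥0∞) :=
  {ρ | Measurable ρ ∧ ∀ c ∈ C ∩ epsChains X ε, 1 ≤ c.integral ρ}

/-- The `(ε, p)`-chain modulus of a family of chains with respect to the class `F` of functions
and the measure `μ`. -/
def chainModulus {X : Type*} [MetricSpace X] [MeasurableSpace X]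
    (ε p : ℝ) (C : Set (Chain X)) (F : Set (X → ℝ≥0∞)) (μ : Measure X) : ℝ≥0∞ :=
  ⨅ ρ ∈ chainAdm ε C ∩ F, ∫⁻ z, ρ z ^ p ∂μ

/-- The class of `[0, ∞]`-valued Borel functions which are finite at `x` and at `y`. -/
def borelFiniteAt {X : Type*} [MeasurableSpace X] (x y : X) : Set (X → ℝ≥0∞) :=
  {g | Measurable g ∧ g x < ∞ ∧ g y < ∞}

/-- The non-negative real-valued Lipschitz functions, viewed as functions into `[0, ∞]`. -/
def lipschitzFunctions (X : Type*) [MetricSpace X] : Set (X → ℝ≥0∞) :=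
  {g | ∃ (u : X → ℝ≥0) (K : ℝ≥0), LipschitzWith K u ∧ ∀ z, g z = u z}

end ChainModulus

end

namespace ChainModulus

variable {X : Type*} [MetricSpace X]

/-! ### Arc-length parametrization -/

/-! Chain moduli decrease as `ε` does, and the Lipschitz class lies in the class finite at the
poles. It thus suffices to bound the curve modulus by every chain modulus of the larger class, and
to push some Lipschitz chain modulus below any `b` above the curve modulus.

Lower bound (`mem_curveAdm_of_mem_chainAdm`): a chain-admissible `ρ` finite at `x` and `y` is
curve-admissible. Sample an arc-length parametrized curve with step `h = ℓ / n` and average over the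
offset. The chain sums average to at most `∫_γ ρ + h (ρ x + ρ y) / 2`, and the error vanishes as `n
→ ∞`.

Upper bound (`exists_lipschitz_mem_chainAdm`): by Vitali–Carathéodory an almost optimal `ρ` may be
replaced by a lower semicontinuous `g ≥ ρ`. Let `g_n ↑ g` be Lipschitz and `σ > 0`. If no `g_n + σ`
were admissible for `1 / (n + 1)`-chains, there would be chains with integral at most `1`, hence of
length at most `1 / σ`. Doubling makes `X` proper, so these chains accumulate at a curve with `∫ (g
+ σ) ≤ 1`, whereas admissibility of `g` gives at least `1 + σ d(x,y)`. Adding `σ` costs little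
because doubling also makes the Riesz measure finite. -/

theorem continuousOn_variationOnFromTo {f : ℝ → X} {s : Set ℝ}
    (hf : LocallyBoundedVariationOn f s) (hc : ContinuousOn f s) {a : ℝ} (ha : a ∈ s) :
    ContinuousOn (variationOnFromTo f s a) s := by
  intro b hb
  have hleft := variationOnFromTo.tendsto_left ha hb hf ((hc b hb).mono inter_subset_left)
  have hright := variationOnFromTo.tendsto_right ha hb hf ((hc b hb).mono inter_subset_left)
  -- The one-sided limits of the variation function differ from its value by the jump of `f`, which
  -- vanishes by continuity.
  rw [dist_self, sub_zero] at hleft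
  rw [dist_self, add_zero] at hright
  have hs : s ⊆ (s ∩ Iio b ∪ s ∩ Ioi b) ∪ {b} := by
    intro z hz
    rcases lt_trichotomy z b with h | h | h
    · exact Or.inl (Or.inl ⟨hz, h⟩)
    · exact Or.inr h
    · exact Or.inl (Or.inr ⟨hz, h⟩)
  refine ContinuousWithinAt.mono ?_ hs
  exact (ContinuousWithinAt.union hleft hright).union continuousWithinAt_singleton

theorem Curve.Rectifiable.locallyBoundedVariationOn {γ : Curve X} (hγ : γ.Rectifiable) :
    LocallyBoundedVariationOn γ.toFun (Icc γ.a γ.b) :=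
  BoundedVariationOn.locallyBoundedVariationOn hγ

/-- The length function of a curve. -/
noncomputable def Curve.lengthFn (γ : Curve X) : ℝ → ℝ :=
  variationOnFromTo γ.toFun (Icc γ.a γ.b) γ.a

theorem Curve.left_mem (γ : Curve X) : γ.a ∈ Icc γ.a γ.b := left_mem_Icc.2 γ.lt.le

theorem Curve.right_mem (γ : Curve X) : γ.b ∈ Icc γ.a γ.b := right_mem_Icc.2 γ.lt.le

theorem Curve.lengthFn_left (γ : Curve X) : γ.lengthFn γ.a = 0 := variationOnFromTo.self _ _ _

theorem Curve.lengthFn_right (γ : Curve X) : γ.lengthFn γ.b = γ.length.toReal := by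
  rw [Curve.lengthFn, variationOnFromTo.eq_of_le _ _ γ.lt.le, inter_self]
  rfl

theorem Curve.Rectifiable.monotoneOn_lengthFn {γ : Curve X} (hγ : γ.Rectifiable) :
    MonotoneOn γ.lengthFn (Icc γ.a γ.b) :=
  variationOnFromTo.monotoneOn hγ.locallyBoundedVariationOn γ.left_mem

theorem Curve.Rectifiable.continuousOn_lengthFn {γ : Curve X} (hγ : γ.Rectifiable) :
    ContinuousOn γ.lengthFn (Icc γ.a γ.b) :=
  continuousOn_variationOnFromTo hγ.locallyBoundedVariationOn γ.continuousOn γ.left_mem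

theorem Curve.Rectifiable.image_lengthFn {γ : Curve X} (hγ : γ.Rectifiable) :
    γ.lengthFn '' Icc γ.a γ.b = Icc 0 γ.length.toReal := by
  apply Subset.antisymm
  · rintro _ ⟨t, ht, rfl⟩
    rw [← γ.lengthFn_left, ← γ.lengthFn_right]
    exact ⟨hγ.monotoneOn_lengthFn γ.left_mem ht ht.1, hγ.monotoneOn_lengthFn ht γ.right_mem ht.2⟩
  · rw [← γ.lengthFn_left, ← γ.lengthFn_right]
    exact intermediate_value_Icc γ.lt.le hγ.continuousOn_lengthFn

/-- Unit speed makes the natural parametrization 1-Lipschitz on `[0, ℓ]`. Composing with the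
projection onto `[0, ℓ]` extends it by constants, so that sampling may overshoot the endpoints. -/
theorem Curve.Rectifiable.exists_arclength {γ : Curve X} (hγ : γ.Rectifiable) :
    ∃ F : ℝ → X, LipschitzWith 1 F ∧ (∀ t ≤ 0, F t = γ.toFun γ.a) ∧
      (∀ t, γ.length.toReal ≤ t → F t = γ.toFun γ.b) ∧
      (∀ g : X → ℝ≥0∞, γ.integral g = ∫⁻ t in Icc 0 γ.length.toReal, g (F t)) ∧
      ∀ t ∈ Icc γ.a γ.b, F (γ.lengthFn t) = γ.toFun t := by
  set ℓ := γ.length.toReal with hℓ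
  have hℓ0 : 0 ≤ ℓ := ENNReal.toReal_nonneg
  set G := naturalParameterization γ.toFun (Icc γ.a γ.b) γ.a with hG
  have hGγ : ∀ t ∈ Icc γ.a γ.b, G (γ.lengthFn t) = γ.toFun t := fun t ht =>
    edist_eq_zero.1
      (edist_naturalParameterization_eq_zero hγ.locallyBoundedVariationOn γ.left_mem ht)
  have hunit : HasUnitSpeedOn G (Icc 0 ℓ) := by
    have := has_unit_speed_naturalParameterization γ.toFun hγ.locallyBoundedVariationOn γ.left_mem
    rwa [← Curve.lengthFn, hγ.image_lengthFn] at this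
  have hlip : LipschitzOnWith 1 G (Icc 0 ℓ) := by
    have key : ∀ s ∈ Icc 0 ℓ, ∀ t ∈ Icc 0 ℓ, s ≤ t → edist (G s) (G t) ≤ edist s t := by
      intro s hs t ht hst
      have h := hunit hs ht
      calc edist (G s) (G t) ≤ eVariationOn G (Icc 0 ℓ ∩ Icc s t) :=
            eVariationOn.edist_le _ ⟨hs, left_mem_Icc.2 hst⟩ ⟨ht, right_mem_Icc.2 hst⟩
        _ = ENNReal.ofReal (t - s) := by rw [h]; simp
        _ = edist s t := by
            rw [edist_comm, edist_dist, Real.dist_eq, abs_of_nonneg (sub_nonneg.2 hst)]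
    intro s hs t ht
    rw [ENNReal.coe_one, one_mul]
    rcases le_total s t with h | h
    · exact key s hs t ht h
    · rw [edist_comm, edist_comm s]; exact key t ht s hs h
  have hFG : ∀ t ∈ Icc 0 ℓ, G (projIcc 0 ℓ hℓ0 t) = G t := fun t ht => by
    rw [projIcc_of_mem hℓ0 ht]
  refine ⟨fun t => G (projIcc 0 ℓ hℓ0 t), ?_, ?_, ?_, ?_, ?_⟩
  · have h1 := hlip.to_restrict
    have := h1.comp (LipschitzWith.projIcc hℓ0)
    rw [mul_one] at this
    exact this
  · intro t ht
    simp only [projIcc_of_le_left hℓ0 ht]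
    rw [← γ.lengthFn_left]
    exact hGγ _ γ.left_mem
  · intro t ht
    simp only [projIcc_of_right_le hℓ0 ht]
    rw [hℓ, ← γ.lengthFn_right]
    exact hGγ _ γ.right_mem
  · intro g
    refine setLIntegral_congr_fun measurableSet_Icc fun t ht => ?_
    exact congrArg g (hFG t ht).symm
  · intro t ht
    have : γ.lengthFn t ∈ Icc 0 ℓ := hγ.image_lengthFn ▸ mem_image_of_mem _ ht
    simp only [hFG _ this]
    exact hGγ t ht

theorem Curve.Rectifiable.dist_le_length {γ : Curve X} (hγ : γ.Rectifiable) :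
    dist (γ.toFun γ.a) (γ.toFun γ.b) ≤ γ.length.toReal := by
  rw [dist_edist]
  exact ENNReal.toReal_mono hγ (eVariationOn.edist_le _ γ.left_mem γ.right_mem)

/-- The curve given by a `1`-Lipschitz map on `[0, T]`. -/
noncomputable def Curve.ofLipschitz {f : ℝ → X} (hf : LipschitzWith 1 f) {T : ℝ} (hT : 0 < T) :
    Curve X where
  a := 0
  b := T
  lt := hT
  toFun := f
  continuousOn := hf.continuous.continuousOn

theorem eVariationOn_le_of_lipschitzWith {f : ℝ → X} (hf : LipschitzWith 1 f) (s t : ℝ) :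
    eVariationOn f (Icc s t) ≤ ENNReal.ofReal (t - s) := by
  have h := hf.lipschitzOnWith (s := univ) |>.comp_eVariationOn_le (f := f) (g := (id : ℝ → ℝ))
    (s := Icc s t) (mapsTo_univ _ _)
  simpa [eVariationOn_id_Icc] using h

theorem Curve.rectifiable_ofLipschitz {f : ℝ → X} (hf : LipschitzWith 1 f) {T : ℝ} (hT : 0 < T) :
    (Curve.ofLipschitz hf hT).Rectifiable :=
  ne_top_of_le_ne_top ENNReal.ofReal_ne_top (eVariationOn_le_of_lipschitzWith hf 0 T)

/-- The length function `v` is 1-Lipschitz and maps onto `[0, ℓ]`, so Lebesgue measure on `[0, ℓ]`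
is dominated by the pushforward under `v` of Lebesgue measure on `[0, T]`. Equality may fail, since
`f` can move at speed less than one. -/
theorem Curve.integral_ofLipschitz_le [MeasurableSpace X] [BorelSpace X] {f : ℝ → X}
    (hf : LipschitzWith 1 f) {T : ℝ} (hT : 0 < T) {g : X → ℝ≥0∞} (hg : Measurable g) :
    (Curve.ofLipschitz hf hT).integral g ≤ ∫⁻ t in Icc 0 T, g (f t) := by
  set γ := Curve.ofLipschitz hf hT with hγdef
  have hγ : γ.Rectifiable := Curve.rectifiable_ofLipschitz hf hT
  obtain ⟨F, hF, -, -, hint, hFγ⟩ := hγ.exists_arclength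
  rw [hint]
  set v := γ.lengthFn with hv
  have hvlip : LipschitzOnWith 1 v (Icc 0 T) := by
    refine LipschitzOnWith.of_le_add_mul _ fun s hs t ht => ?_
    rw [NNReal.coe_one, one_mul]
    rcases le_total s t with h | h
    · exact (hγ.monotoneOn_lengthFn hs ht h).trans (le_add_of_nonneg_right dist_nonneg)
    · have h1 : v s - v t = variationOnFromTo f (Icc 0 T) t s :=
        variationOnFromTo.sub_right hγ.locallyBoundedVariationOn γ.left_mem hs ht
      have h2 : variationOnFromTo f (Icc 0 T) t s ≤ s - t := by
        rw [variationOnFromTo.eq_of_le _ _ h]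
        refine ENNReal.toReal_le_of_le_ofReal (sub_nonneg.2 h) ?_
        exact (eVariationOn.mono _ inter_subset_right).trans
          (eVariationOn_le_of_lipschitzWith hf t s)
      rw [Real.dist_eq, abs_of_nonneg (sub_nonneg.2 h)]
      linarith
  have hvm : AEMeasurable v (volume.restrict (Icc 0 T)) :=
    hγ.continuousOn_lengthFn.aemeasurable measurableSet_Icc
  have hle : volume.restrict (Icc 0 γ.length.toReal) ≤ (volume.restrict (Icc 0 T)).map v := by
    refine Measure.le_iff.2 fun A hA => ?_
    rw [Measure.map_apply_of_aemeasurable hvm hA, Measure.restrict_apply hA,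
      Measure.restrict_apply' measurableSet_Icc]
    have hsub : A ∩ Icc 0 γ.length.toReal ⊆ v '' (v ⁻¹' A ∩ Icc 0 T) := by
      rintro r ⟨hrA, hr⟩
      rw [← hγ.image_lengthFn] at hr
      obtain ⟨t, ht, rfl⟩ := hr
      exact ⟨t, ⟨hrA, ht⟩, rfl⟩
    refine (measure_mono hsub).trans ?_
    have := (hvlip.mono inter_subset_right : LipschitzOnWith 1 v (v ⁻¹' A ∩ Icc 0 T)
      ).hausdorffMeasure_image_le zero_le_one
    simpa [hausdorffMeasure_real] using this
  have hgF : Measurable fun t => g (F t) := hg.comp hF.continuous.measurable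
  calc ∫⁻ t in Icc 0 γ.length.toReal, g (F t)
      ≤ ∫⁻ t, g (F t) ∂((volume.restrict (Icc 0 T)).map v) := lintegral_mono' hle le_rfl
    _ = ∫⁻ t in Icc 0 T, g (F (v t)) := lintegral_map' hgF.aemeasurable hvm
    _ = ∫⁻ t in Icc 0 T, g (f t) :=
      setLIntegral_congr_fun measurableSet_Icc fun t ht => by
        simp only [hFγ t ht]
        rfl

end ChainModulus

namespace ChainModulus

variable {X : Type*} [MetricSpace X]

/-! ### Chains given by sequences -/

/-- The chain `q 0, …, q N`. -/
def Chain.ofSeq {X : Type*} (N : ℕ) (q : ℕ → X) : Chain X := ⟨N, fun i => q i⟩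

theorem Chain.exists_eq_ofSeq {X : Type*} (c : Chain X) :
    ∃ (N : ℕ) (q : ℕ → X), c = Chain.ofSeq N q := by
  refine ⟨c.N, fun i => c.q ⟨min i c.N, by omega⟩, ?_⟩
  cases c with
  | mk N q =>
    simp only [Chain.ofSeq, Chain.mk.injEq, heq_eq_eq, true_and]
    funext i
    congr 1
    ext
    simp only
    omega

theorem Chain.integral_ofSeq (N : ℕ) (q : ℕ → X) (g : X → ℝ≥0∞) :
    (Chain.ofSeq N q).integral g = ∑ i ∈ Finset.range N,
      (g (q i) + g (q (i + 1))) / 2 * ENNReal.ofReal (dist (q i) (q (i + 1))) :=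
  Fin.sum_univ_eq_sum_range (fun i => (g (q i) + g (q (i + 1))) / 2 *
    ENNReal.ofReal (dist (q i) (q (i + 1)))) N

theorem Chain.ofSeq_mem_chainsBetween {X : Type*} {N : ℕ} {q : ℕ → X} {x y : X} :
    Chain.ofSeq N q ∈ chainsBetween x y ↔ q 0 = x ∧ q N = y := by
  simp [chainsBetween, Chain.ofSeq]

theorem Chain.ofSeq_mem_epsChains {N : ℕ} {q : ℕ → X} {ε : ℝ} :
    Chain.ofSeq N q ∈ epsChains X ε ↔ ∀ i < N, dist (q i) (q (i + 1)) ≤ ε :=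
  ⟨fun h i hi => h ⟨i, hi⟩, fun h i => h i i.2⟩

/-! ### From chains to curves -/

theorem sum_lintegral_Ioc_add_mul (φ : ℝ → ℝ≥0∞) {h : ℝ} (hh : 0 ≤ h) (n : ℕ) :
    ∑ i ∈ Finset.range n, ∫⁻ t in Ioc 0 h, φ (t + i * h) = ∫⁻ t in Ioc 0 (n * h), φ t := by
  induction n with
  | zero => simp
  | succ n ih =>
    have hn : (0 : ℝ) ≤ n * h := by positivity
    have hshift : ∫⁻ t in Ioc 0 h, φ (t + n * h) =
        ∫⁻ t in Ioc (n * h : ℝ) ((n + 1 : ℕ) * h), φ t := by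
      rw [← lintegral_indicator measurableSet_Ioc, ← lintegral_indicator measurableSet_Ioc,
        ← lintegral_add_right_eq_self ((Ioc (n * h : ℝ) ((n + 1 : ℕ) * h)).indicator φ) (n * h : ℝ)]
      refine lintegral_congr fun t => ?_
      rw [indicator_apply, indicator_apply]
      refine if_congr ?_ rfl rfl
      simp only [mem_Ioc]
      push_cast
      constructor <;> rintro ⟨h1, h2⟩ <;> constructor <;> linarith
    have hun : Ioc (0 : ℝ) ((n + 1 : ℕ) * h) =
        Ioc 0 (n * h : ℝ) ∪ Ioc (n * h : ℝ) ((n + 1 : ℕ) * h) := by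
      rw [Ioc_union_Ioc_eq_Ioc hn]
      push_cast
      nlinarith
    rw [Finset.sum_range_succ, ih, hshift, hun, lintegral_union measurableSet_Ioc]
    exact Ioc_disjoint_Ioc_of_le le_rfl

/-- A single sampled chain says nothing about the integral of a merely Borel `ρ`; averaging over all
offsets `t ∈ (0, h]` does, since the translated sampling intervals tile `(0, ℓ]`. -/
theorem one_le_lintegral_add_of_mem_chainAdm [MeasurableSpace X] [BorelSpace X] {x y : X} {ε : ℝ}
    {ρ : X → ℝ≥0∞} (hρ : ρ ∈ chainAdm ε (chainsBetween x y)) {F : ℝ → X} (hF : LipschitzWith 1 F)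
    {ℓ : ℝ} (hx : ∀ t ≤ 0, F t = x) (hy : ∀ t, ℓ ≤ t → F t = y) {h : ℝ} (hh : 0 < h)
    (hhε : h ≤ ε) {n : ℕ} (hn : n * h = ℓ) :
    1 ≤ (∫⁻ t in Icc 0 ℓ, ρ (F t)) + (ρ x + ρ y) / 2 * ENNReal.ofReal h := by
  set H := ENNReal.ofReal h with hH
  have hmeas : Measurable fun t => ρ (F t) := hρ.1.comp hF.continuous.measurable
  have hpt : ∀ t ∈ Ioc 0 h, 1 ≤ (∑ i ∈ Finset.range n, ρ (F (t + i * h))) * H +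
      (ρ x + ρ y) / 2 * H := by
    rintro t ⟨ht0, hth⟩
    -- The shift by `-1` puts `q 0` at a parameter `t - h ≤ 0` and `q (n + 1)` at `t + n h ≥ ℓ`, so
    -- the chain starts at `x` and ends at `y` for every offset.
    set q : ℕ → X := fun i => F (t + ((i : ℝ) - 1) * h) with hq
    have hdist : ∀ i, dist (q i) (q (i + 1)) ≤ h := by
      intro i
      refine (hF.dist_le_mul _ _).trans ?_
      rw [NNReal.coe_one, one_mul, Real.dist_eq]
      push_cast
      rw [show t + ((i : ℝ) - 1) * h - (t + ((i : ℝ) + 1 - 1) * h) = -h by ring, abs_neg,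
        abs_of_pos hh]
    have hq0 : q 0 = x := hx _ (by push_cast; linarith)
    have hqn : q (n + 1) = y := hy _ (by push_cast; linarith)
    have h1 : 1 ≤ (Chain.ofSeq (n + 1) q).integral ρ :=
      hρ.2 _ ⟨Chain.ofSeq_mem_chainsBetween.2 ⟨hq0, hqn⟩,
        Chain.ofSeq_mem_epsChains.2 fun i _ => (hdist i).trans hhε⟩
    rw [Chain.integral_ofSeq] at h1
    refine h1.trans ?_
    calc ∑ i ∈ Finset.range (n + 1),
          (ρ (q i) + ρ (q (i + 1))) / 2 * ENNReal.ofReal (dist (q i) (q (i + 1)))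
        ≤ ∑ i ∈ Finset.range (n + 1), (ρ (q i) + ρ (q (i + 1))) / 2 * H := by
          refine Finset.sum_le_sum fun i _ => ?_
          exact mul_le_mul_right (ENNReal.ofReal_le_ofReal (hdist i)) _
      -- Interior vertices belong to two trapezoids and get full weight; the endpoints get weight
      -- one half.
      _ = (∑ i ∈ Finset.range n, ρ (q (i + 1))) * H + (ρ x + ρ y) / 2 * H := by
          rw [← Finset.sum_mul, ← add_mul]
          congr 1
          simp only [ENNReal.add_div]
          rw [Finset.sum_add_distrib, Finset.sum_range_succ', Finset.sum_range_succ, hq0, hqn]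
          have : ∑ i ∈ Finset.range n, ρ (q (i + 1)) =
              ∑ i ∈ Finset.range n, ρ (q (i + 1)) / 2 +
                ∑ i ∈ Finset.range n, ρ (q (i + 1)) / 2 := by
            rw [← Finset.sum_add_distrib]
            simp only [ENNReal.add_halves]
          rw [this]
          ring
      _ = (∑ i ∈ Finset.range n, ρ (F (t + i * h))) * H + (ρ x + ρ y) / 2 * H := by
          simp [hq]
  have hint : H ≤ ((∫⁻ t in Icc 0 ℓ, ρ (F t)) + (ρ x + ρ y) / 2 * H) * H := by
    calc H = ∫⁻ _ in Ioc 0 h, 1 := by simp [hH]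
      _ ≤ ∫⁻ t in Ioc 0 h, ((∑ i ∈ Finset.range n, ρ (F (t + i * h))) * H +
            (ρ x + ρ y) / 2 * H) := setLIntegral_mono' measurableSet_Ioc hpt
      _ = ((∫⁻ t in Icc 0 ℓ, ρ (F t)) + (ρ x + ρ y) / 2 * H) * H := by
          have hm : ∀ i : ℕ, Measurable fun t : ℝ => ρ (F (t + i * h)) := fun i =>
            hmeas.comp (measurable_id.add_const _)
          rw [lintegral_add_right _ measurable_const, lintegral_mul_const _
            (Finset.measurable_fun_sum _ fun i _ => hm i), lintegral_finsetSum _ fun i _ => hm i,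
            sum_lintegral_Ioc_add_mul (fun t => ρ (F t)) hh.le, hn,
            setLIntegral_congr Ioc_ae_eq_Icc, add_mul]
          simp [hH]
  have hH0 : H ≠ 0 := by simpa [hH] using hh
  have hHt : H ≠ ∞ := ENNReal.ofReal_ne_top
  rw [← ENNReal.mul_le_mul_iff_left hH0 hHt, one_mul]
  exact hint

/-- Finiteness at the poles is what makes the error `(ρ x + ρ y) / 2 * (ℓ / n)` tend to zero. -/
theorem mem_curveAdm_of_mem_chainAdm [MeasurableSpace X] [BorelSpace X] {x y : X} {ε : ℝ}
    (hε : 0 < ε) {ρ : X → ℝ≥0∞} (hρ : ρ ∈ chainAdm ε (chainsBetween x y)) (hx : ρ x < ∞)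
    (hy : ρ y < ∞) : ρ ∈ curveAdm (curvesBetween x y) := by
  rintro γ ⟨hγ, hγx, hγy⟩
  obtain ⟨F, hF, hF0, hFℓ, hint, -⟩ := hγ.exists_arclength
  rw [hint]
  rw [hγx] at hF0
  rw [hγy] at hFℓ
  have hlen := hγ.dist_le_length
  rw [hγx, hγy] at hlen
  set ℓ := γ.length.toReal
  rcases eq_or_ne x y with rfl | hxy
  -- For `x = y` the one-point chain has integral `0`, so nothing is chain-admissible.
  · have h := hρ.2 (Chain.ofSeq 0 fun _ => x) ⟨Chain.ofSeq_mem_chainsBetween.2 ⟨rfl, rfl⟩,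
      Chain.ofSeq_mem_epsChains.2 fun i hi => absurd hi (Nat.not_lt_zero i)⟩
    simp [Chain.integral_ofSeq] at h
  have hℓ : 0 < ℓ := (dist_pos.2 hxy).trans_le hlen
  have hlim0 : Tendsto (fun n : ℕ => ℓ / n) atTop (𝓝 0) := tendsto_const_div_atTop_nhds_zero_nat ℓ
  have hfin : (ρ x + ρ y) / 2 ≠ ∞ :=
    ENNReal.div_ne_top (ENNReal.add_ne_top.2 ⟨hx.ne, hy.ne⟩) two_ne_zero
  have hlim : Tendsto (fun n : ℕ => (∫⁻ t in Icc 0 ℓ, ρ (F t)) +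
      (ρ x + ρ y) / 2 * ENNReal.ofReal (ℓ / n)) atTop (𝓝 (∫⁻ t in Icc 0 ℓ, ρ (F t))) := by
    have h1 := ENNReal.Tendsto.const_mul (a := (ρ x + ρ y) / 2) (ENNReal.tendsto_ofReal hlim0)
      (Or.inr hfin)
    simpa using tendsto_const_nhds.add h1
  refine ge_of_tendsto hlim ?_
  filter_upwards [hlim0.eventually_le_const hε, eventually_gt_atTop 0] with n hn hn0
  have hn0' : (0 : ℝ) < n := Nat.cast_pos.2 hn0
  exact one_le_lintegral_add_of_mem_chainAdm hρ hF hF0 hFℓ (div_pos hℓ hn0') hn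
    (mul_div_cancel₀ _ hn0'.ne')

theorem curveModulus_le_chainModulus [MeasurableSpace X] [BorelSpace X] {x y : X} {ε : ℝ}
    (hε : 0 < ε) (p : ℝ) (μ : Measure X) :
    curveModulus p (curvesBetween x y) μ ≤
      chainModulus ε p (chainsBetween x y) (borelFiniteAt x y) μ :=
  le_iInf₂ fun ρ hρ => iInf₂_le ρ
    ⟨mem_curveAdm_of_mem_chainAdm hε hρ.1 hρ.2.2.1 hρ.2.2.2, hρ.2.1⟩

end ChainModulus

namespace ChainModulus

variable {X : Type*} [MetricSpace X] [MeasurableSpace X] {m : Measure X}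

/-! ### Doubling measures -/

theorem measure_ball_two_pow_mul_le {C : ℝ≥0}
    (hC : ∀ (x : X) (r : ℝ), 0 < r → m (Metric.ball x (2 * r)) ≤ C * m (Metric.ball x r))
    (x : X) {r : ℝ} (hr : 0 < r) (k : ℕ) :
    m (Metric.ball x (2 ^ k * r)) ≤ (C : ℝ≥0∞) ^ k * m (Metric.ball x r) := by
  induction k with
  | zero => simp
  | succ k ih =>
    calc m (Metric.ball x (2 ^ (k + 1) * r)) = m (Metric.ball x (2 * (2 ^ k * r))) := by
          rw [pow_succ', mul_assoc]
      _ ≤ C * m (Metric.ball x (2 ^ k * r)) := hC x _ (by positivity)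
      _ ≤ C * ((C : ℝ≥0∞) ^ k * m (Metric.ball x r)) := mul_le_mul_right ih _
      _ = (C : ℝ≥0∞) ^ (k + 1) * m (Metric.ball x r) := by rw [pow_succ', mul_assoc]

theorem exists_le_two_pow_mul (R : ℝ) {r : ℝ} (hr : 0 < r) : ∃ k : ℕ, R < 2 ^ k * r := by
  obtain ⟨k, hk⟩ := pow_unbounded_of_one_lt (R / r) one_lt_two
  exact ⟨k, (div_lt_iff₀ hr).1 hk⟩

/-- A null ball would have null dilates by doubling, and these exhaust `X`. -/
theorem IsDoubling.measure_ball_ne_zero (hd : IsDoubling m) (hm : m ≠ 0) (x : X) {r : ℝ}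
    (hr : 0 < r) : m (Metric.ball x r) ≠ 0 := by
  obtain ⟨C, -, hC⟩ := hd
  intro h0
  refine hm (Measure.measure_univ_eq_zero.1 ?_)
  have huniv : (univ : Set X) = ⋃ k : ℕ, Metric.ball x (2 ^ k * r) := by
    refine (eq_univ_of_forall fun z => ?_).symm
    obtain ⟨k, hk⟩ := exists_le_two_pow_mul (dist z x) hr
    exact mem_iUnion.2 ⟨k, hk⟩
  rw [huniv]
  refine measure_iUnion_null fun k => ?_
  have := measure_ball_two_pow_mul_le hC x hr k
  rwa [h0, mul_zero, nonpos_iff_eq_zero] at this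

/-- Otherwise there is an infinite `ε`-separated sequence. The disjoint balls of radius `ε / 2`
around its points have masses bounded below by doubling, yet all lie in one ball of finite mass. -/
theorem IsDoubling.totallyBounded_closedBall [OpensMeasurableSpace X] (hd : IsDoubling m)
    (hm : IsMetricMeasure m) (x : X) (R : ℝ) : TotallyBounded (Metric.closedBall x R) := by
  obtain ⟨C, hC1, hC⟩ := id hd
  refine Metric.totallyBounded_iff.2 fun ε hε => ?_
  by_contra hcon
  push Not at hcon
  obtain ⟨f, hfR, hfε⟩ := exists_seq_of_forall_finset_exists (fun z => z ∈ Metric.closedBall x R)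
    (fun z w => ε ≤ dist w z) fun s _ => by
      obtain ⟨z, hz, hzs⟩ := not_subset.1 (hcon s s.finite_toSet)
      refine ⟨z, hz, fun w hw => ?_⟩
      by_contra! hlt
      exact hzs (mem_iUnion₂.2 ⟨w, hw, hlt⟩)
  have hR : 0 ≤ R := dist_nonneg.trans (Metric.mem_closedBall.1 (hfR 0))
  -- A ball of radius `2 R + ε` around any `f i` contains the ball of radius `R + ε` around `x`.
  obtain ⟨k, hk⟩ := exists_le_two_pow_mul (2 * R + ε) (half_pos hε)
  have hCk0 : (C : ℝ≥0∞) ^ k ≠ 0 := pow_ne_zero _ (by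
    rw [ENNReal.coe_ne_zero]; exact (zero_lt_one.trans_le hC1).ne')
  have hCkt : (C : ℝ≥0∞) ^ k ≠ ∞ := ENNReal.pow_ne_top ENNReal.coe_ne_top
  have hball : ∀ i, m (Metric.ball x (R + ε)) / (C : ℝ≥0∞) ^ k ≤ m (Metric.ball (f i) (ε / 2)) := by
    intro i
    rw [ENNReal.div_le_iff' hCk0 hCkt]
    refine le_trans (measure_mono ?_) (measure_ball_two_pow_mul_le hC (f i) (half_pos hε) k)
    refine Metric.ball_subset_ball' ?_
    have := Metric.mem_closedBall'.1 (hfR i)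
    linarith
  have hdisj : Pairwise (Function.onFun Disjoint fun i => Metric.ball (f i) (ε / 2)) := by
    have hlt : ∀ i j, i < j → Disjoint (Metric.ball (f i) (ε / 2)) (Metric.ball (f j) (ε / 2)) :=
      fun i j hij => Metric.ball_disjoint_ball (by
        rw [add_halves, dist_comm]
        exact hfε i j hij)
    intro i j hij
    rcases lt_or_gt_of_ne hij with h | h
    · exact hlt i j h
    · exact (hlt j i h).symm
  have hfin := Measure.finite_const_le_meas_of_disjoint_iUnion m
    (ENNReal.div_pos (hd.measure_ball_ne_zero hm.nontrivial x (by linarith : 0 < R + ε)) hCkt)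
    (fun i => (Metric.isOpen_ball (x := f i) (ε := ε / 2)).measurableSet) hdisj
    (ne_top_of_le_ne_top (hm.finite_of_bounded _ (Metric.isBounded_ball (x := x) (r := R + ε))).ne
      (measure_mono (iUnion_subset fun i => Metric.ball_subset_ball' (by
        have := Metric.mem_closedBall.1 (hfR i)
        linarith))))
  exact infinite_univ (hfin.subset fun i _ => hball i)

theorem IsDoubling.properSpace [OpensMeasurableSpace X] [CompleteSpace X] (hd : IsDoubling m)
    (hm : IsMetricMeasure m) : ProperSpace X :=
  ⟨fun x R => isCompact_iff_totallyBounded_isComplete.2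
    ⟨hd.totallyBounded_closedBall hm x R, Metric.isClosed_closedBall.isComplete⟩⟩

/-! ### Finiteness of the Riesz measure -/

/-- On the annulus between radii `r (k + 1)` and `r k = 2 * r (k + 1)`, the integrand is at most `r
k / m (B_{r (k + 1)})` and the mass at most `C * m (B_{r (k + 1)})`. The contributions `C * r k`
form a geometric series. -/
theorem IsDoubling.setLIntegral_dist_div_measure_ball_ne_top [OpensMeasurableSpace X]
    (hd : IsDoubling m) (x : X) {R : ℝ} (hR : 0 < R) :
    ∫⁻ z in Metric.ball x R, ENNReal.ofReal (dist x z) / m (Metric.ball x (dist x z)) ∂m ≠ ∞ := by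
  obtain ⟨C, -, hC⟩ := hd
  set w : X → ℝ≥0∞ := fun z => ENNReal.ofReal (dist x z) / m (Metric.ball x (dist x z)) with hw
  set r : ℕ → ℝ := fun k => (1 / 2) ^ k * R with hr
  have hr0 : ∀ k, 0 < r k := fun k => by positivity
  have hr2 : ∀ k, r k = 2 * r (k + 1) := fun k => by simp only [hr, pow_succ]; ring
  set A : ℕ → Set X := fun k => Metric.ball x (r k) \ Metric.ball x (r (k + 1)) with hA
  have hcover : Metric.ball x R ⊆ {x} ∪ ⋃ k, A k := by
    intro z hz
    rcases eq_or_ne z x with rfl | hne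
    · exact Or.inl rfl
    refine Or.inr ?_
    have hz0 : 0 < dist z x := dist_pos.2 hne
    have hex : ∃ k, r k ≤ dist z x := by
      obtain ⟨k, hk⟩ := exists_pow_lt_of_lt_one (div_pos hz0 hR)
        (by norm_num : (1 / 2 : ℝ) < 1)
      exact ⟨k, ((lt_div_iff₀ hR).1 hk).le⟩
    classical
    obtain ⟨k, hk⟩ : ∃ k, Nat.find hex = k + 1 := by
      refine Nat.exists_eq_succ_of_ne_zero fun h0 => ?_
      have := Nat.find_spec hex
      rw [h0] at this
      simp only [hr, pow_zero, one_mul] at this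
      exact absurd (Metric.mem_ball.1 hz) (not_lt.2 this)
    refine mem_iUnion.2 ⟨k, ?_, ?_⟩
    · have := Nat.find_min hex (m := k) (by omega)
      exact not_le.1 this
    · have := Nat.find_spec hex
      rw [hk] at this
      exact not_lt.2 this
  -- At the pole the integrand is `0 / 0 = 0`, so even an atom at `x` contributes nothing.
  have hx : ∫⁻ z in ({x} : Set X), w z ∂m = 0 := by
    refine (setLIntegral_congr_fun (measurableSet_singleton x) (g := fun _ => 0) ?_).trans (by simp)
    rintro z rfl
    simp [hw]
  have hAk : ∀ k, ∫⁻ z in A k, w z ∂m ≤ C * ENNReal.ofReal (r k) := by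
    intro k
    set b := m (Metric.ball x (r (k + 1)))
    calc ∫⁻ z in A k, w z ∂m ≤ ∫⁻ _ in A k, ENNReal.ofReal (r k) / b ∂m := by
          refine setLIntegral_mono' (measurableSet_ball.diff measurableSet_ball) fun z hz => ?_
          have h1 := Metric.mem_ball'.1 hz.1
          have h2 : r (k + 1) ≤ dist x z := not_lt.1 fun h => hz.2 (Metric.mem_ball'.2 h)
          exact ENNReal.div_le_div (ENNReal.ofReal_le_ofReal h1.le)
            (measure_mono (Metric.ball_subset_ball h2))
      _ = ENNReal.ofReal (r k) / b * m (A k) := setLIntegral_const _ _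
      _ ≤ ENNReal.ofReal (r k) / b * (C * b) := by
          refine mul_le_mul_right ((measure_mono sdiff_subset).trans ?_) _
          rw [hr2 k]
          exact hC x _ (hr0 _)
      _ = C * ENNReal.ofReal (r k) * (b / b) := by simp only [div_eq_mul_inv]; ring
      _ ≤ C * ENNReal.ofReal (r k) * 1 := mul_le_mul_right ENNReal.div_self_le_one _
      _ = C * ENNReal.ofReal (r k) := mul_one _
  have hsum : ∑' k, ENNReal.ofReal (r k) ≠ ∞ := by
    have hs : Summable r := (summable_geometric_of_lt_one (by norm_num) (by norm_num)).mul_right R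
    rw [← ENNReal.ofReal_tsum_of_nonneg (fun k => (hr0 k).le) hs]
    exact ENNReal.ofReal_ne_top
  refine ne_top_of_le_ne_top (ENNReal.mul_ne_top (ENNReal.coe_ne_top (r := C)) hsum) ?_
  calc ∫⁻ z in Metric.ball x R, w z ∂m ≤ ∫⁻ z in {x} ∪ ⋃ k, A k, w z ∂m :=
        lintegral_mono_set hcover
    _ ≤ ∫⁻ z in ({x} : Set X), w z ∂m + ∫⁻ z in ⋃ k, A k, w z ∂m := lintegral_union_le _ _ _
    _ ≤ 0 + ∑' k, ∫⁻ z in A k, w z ∂m := add_le_add hx.le (lintegral_iUnion_le _ _)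
    _ ≤ ∑' k, C * ENNReal.ofReal (r k) := by rw [zero_add]; exact ENNReal.tsum_le_tsum hAk
    _ = C * ∑' k, ENNReal.ofReal (r k) := ENNReal.tsum_mul_left

theorem IsDoubling.isFiniteMeasure_rieszMeasure [BorelSpace X] (hd : IsDoubling m)
    {L : ℝ} (hL : 1 ≤ L) {x y : X} (hxy : x ≠ y) : IsFiniteMeasure (rieszMeasure m L x y) := by
  have hdist : 0 < dist x y := dist_pos.2 hxy
  -- With this radius the ball around either pole contains the whole region, so the two terms can be
  -- integrated separately.
  set R := (L + 1) * dist x y with hRdef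
  have hR : 0 < R := by positivity
  set w : X → X → ℝ≥0∞ :=
    fun x z => ENNReal.ofReal (dist x z) / m (Metric.ball x (dist x z)) with hw
  have hwm : ∀ x, Measurable (w x) := fun x => by
    have hmono : Monotone fun r => m (Metric.ball x r) := fun r s hrs =>
      measure_mono (Metric.ball_subset_ball hrs)
    have hdm : Measurable fun z => dist x z := (continuous_const.dist continuous_id).measurable
    exact hdm.ennreal_ofReal.div (hmono.measurable.comp hdm)
  have hle : ∀ z, rieszPotential m L x y z ≤
      (Metric.ball x R).indicator (w x) z + (Metric.ball y R).indicator (w y) z := by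
    intro z
    rw [rieszPotential]
    by_cases hz : z ∈ rieszRegion L x y \ {x, y}
    swap
    · rw [indicator_of_notMem hz]
      exact zero_le
    have htri := dist_triangle z x y
    have htri' := dist_triangle z y x
    rw [dist_comm y x] at htri'
    have hzR : z ∈ Metric.ball x R ∧ z ∈ Metric.ball y R := by
      rcases hz.1 with h | h <;> rw [Metric.mem_ball] at h <;>
        constructor <;> rw [Metric.mem_ball, hRdef] <;> linarith
    rw [indicator_of_mem hz, indicator_of_mem hzR.1, indicator_of_mem hzR.2]
  refine ⟨lt_top_iff_ne_top.2 ?_⟩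
  rw [rieszMeasure, withDensity_apply _ MeasurableSet.univ, Measure.restrict_univ]
  refine ne_top_of_le_ne_top ?_ (lintegral_mono hle)
  rw [lintegral_add_left ((hwm x).indicator measurableSet_ball),
    lintegral_indicator measurableSet_ball, lintegral_indicator measurableSet_ball]
  exact ENNReal.add_ne_top.2 ⟨hd.setLIntegral_dist_div_measure_ball_ne_top x hR,
    hd.setLIntegral_dist_div_measure_ball_ne_top y hR⟩

end ChainModulus

namespace ChainModulus

variable {X : Type*} [MetricSpace X]

/-! ### From chains of bounded length to a limit curve -/

/-- The length of the initial piece `q 0, …, q j` of a sequence. -/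
def partialLength (q : ℕ → X) (j : ℕ) : ℝ :=
  ∑ i ∈ Finset.range j, dist (q i) (q (i + 1))

theorem partialLength_succ (q : ℕ → X) (j : ℕ) :
    partialLength q (j + 1) = partialLength q j + dist (q j) (q (j + 1)) :=
  Finset.sum_range_succ _ _

theorem partialLength_zero (q : ℕ → X) : partialLength q 0 = 0 := Finset.sum_range_zero _

theorem monotone_partialLength (q : ℕ → X) : Monotone (partialLength q) :=
  monotone_nat_of_le_succ fun j => by
    rw [partialLength_succ]
    exact le_add_of_nonneg_right dist_nonneg

theorem partialLength_nonneg (q : ℕ → X) (j : ℕ) : 0 ≤ partialLength q j :=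
  Finset.sum_nonneg fun _ _ => dist_nonneg

theorem dist_le_abs_partialLength_sub (q : ℕ → X) (i j : ℕ) :
    dist (q i) (q j) ≤ |partialLength q i - partialLength q j| := by
  have key : ∀ i j, i ≤ j → dist (q i) (q j) ≤ |partialLength q i - partialLength q j| := by
    intro i j hij
    rw [abs_sub_comm]
    refine (dist_le_Ico_sum_dist q hij).trans (le_trans (le_of_eq ?_) (le_abs_self _))
    rw [Finset.sum_Ico_eq_sub _ hij]
    rfl
  rcases le_total i j with h | h
  · exact key i j h
  · rw [dist_comm, abs_sub_comm]
    exact key j i h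

theorem exists_abs_partialLength_sub_le (q : ℕ → X) {ε : ℝ} (hε : 0 ≤ ε) {N : ℕ}
    (hq : ∀ i < N, dist (q i) (q (i + 1)) ≤ ε) {t : ℝ} (ht0 : 0 ≤ t)
    (ht : t ≤ partialLength q N) : ∃ j ≤ N, |partialLength q j - t| ≤ ε := by
  induction N with
  | zero =>
    refine ⟨0, le_rfl, ?_⟩
    rw [partialLength_zero] at ht ⊢
    rwa [le_antisymm ht ht0, sub_zero, abs_zero]
  | succ N ih =>
    rcases le_or_gt t (partialLength q N) with h | h
    · obtain ⟨j, hj, hjt⟩ := ih (fun i hi => hq i (by omega)) h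
      exact ⟨j, by omega, hjt⟩
    · refine ⟨N + 1, le_rfl, ?_⟩
      rw [abs_of_nonneg (by linarith)]
      have := hq N (by omega)
      rw [partialLength_succ]
      linarith

/-- An Arzelà–Ascoli argument for the discontinuous maps `g n`, where `g n t` is a vertex at
arc-length position within `ε n` of `t` clamped to `[0, S n]`. They are 1-Lipschitz up to an error
`2 * ε n` and take values in a compact ball. -/
theorem exists_lipschitz_limit [ProperSpace X] {x y : X} {N : ℕ → ℕ} {q : ℕ → ℕ → X} {ε : ℕ → ℝ}
    {M : ℝ} (h0 : ∀ n, q n 0 = x) (hN : ∀ n, q n (N n) = y) (hε0 : ∀ n, 0 ≤ ε n)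
    (hε : Tendsto ε atTop (𝓝 0)) (hq : ∀ n, ∀ i < N n, dist (q n i) (q n (i + 1)) ≤ ε n)
    (hM : ∀ n, partialLength (q n) (N n) ≤ M) :
    ∃ (T : ℝ) (f : ℝ → X), T ∈ Icc 0 M ∧ LipschitzWith 1 f ∧ f 0 = x ∧ f T = y ∧
      ∀ η > 0, ∃ᶠ n in atTop, |partialLength (q n) (N n) - T| ≤ η ∧
        ∀ j ≤ N n, dist (f (partialLength (q n) j)) (q n j) ≤ η := by
  set S : ℕ → ℝ := fun n => partialLength (q n) (N n) with hS
  have hS0 : ∀ n, 0 ≤ S n := fun n => partialLength_nonneg _ _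
  have hj : ∀ n t, ∃ j ≤ N n, |partialLength (q n) j - max 0 (min t (S n))| ≤ ε n := fun n t =>
    exists_abs_partialLength_sub_le (q n) (hε0 n) (hq n) (le_max_left _ _)
      (max_le (hS0 n) (min_le_right _ _))
  choose j hjN hjt using hj
  set g : ℕ → ℝ → X := fun n t => q n (j n t) with hg
  have hgball : ∀ n t, g n t ∈ Metric.closedBall x M := by
    intro n t
    have h1 := dist_le_abs_partialLength_sub (q n) (j n t) 0
    rw [h0, partialLength_zero, sub_zero, abs_of_nonneg (partialLength_nonneg _ _)] at h1
    exact h1.trans ((monotone_partialLength _ (hjN n t)).trans (hM n))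
  have hgq : ∀ n t i, dist (g n t) (q n i) ≤
      ε n + |max 0 (min t (S n)) - partialLength (q n) i| := fun n t i =>
    (dist_le_abs_partialLength_sub (q n) _ _).trans
      ((abs_sub_le _ (max 0 (min t (S n))) _).trans (add_le_add_left (hjt n t) _))
  -- Limits along a free ultrafilter exist for all `t` at once, which replaces the diagonal
  -- extraction of a subsequence.
  set U : Ultrafilter ℕ := hyperfilter ℕ with hU
  have hUtop : (U : Filter ℕ) ≤ atTop := Nat.hyperfilter_le_atTop
  have hf : ∀ t, ∃ z, Tendsto (fun n => g n t) U (𝓝 z) := by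
    intro t
    obtain ⟨z, -, hz⟩ := (isCompact_closedBall x M).ultrafilter_le_nhds (U.map fun n => g n t)
      (le_principal_iff.2 (mem_map.2 (univ_mem' fun n => hgball n t)))
    exact ⟨z, hz⟩
  choose f hf using hf
  obtain ⟨T, hTM, hT⟩ : ∃ T ∈ Icc 0 M, Tendsto S U (𝓝 T) := by
    obtain ⟨T, hTM, hT⟩ := (isCompact_Icc (a := (0 : ℝ)) (b := M)).ultrafilter_le_nhds (U.map S)
      (le_principal_iff.2 (mem_map.2 (univ_mem' fun n => ⟨hS0 n, hM n⟩)))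
    exact ⟨T, hTM, hT⟩
  have hεU : Tendsto ε U (𝓝 0) := hε.mono_left hUtop
  have hfl : LipschitzWith 1 f := by
    refine LipschitzWith.of_dist_le_mul fun s t => ?_
    rw [NNReal.coe_one, one_mul, Real.dist_eq]
    have hlim : Tendsto (fun n => ε n + (ε n + |s - t|)) U (𝓝 (0 + (0 + |s - t|))) :=
      hεU.add (hεU.add_const _)
    rw [zero_add, zero_add] at hlim
    refine le_of_tendsto_of_tendsto' ((hf s).dist (hf t)) hlim fun n => ?_
    refine (hgq n s (j n t)).trans (add_le_add_right ?_ _)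
    refine (abs_sub_le _ (max 0 (min t (S n))) _).trans ?_
    rw [add_comm]
    refine add_le_add (by rw [abs_sub_comm]; exact hjt n t) ?_
    exact (abs_max_sub_max_le_max _ _ _ _).trans (max_le (by simp)
      ((abs_min_sub_min_le_max _ _ _ _).trans (by simp)))
  have hend : ∀ (t : ℝ) (i : ℕ → ℕ) (z : X), (∀ n, q n (i n) = z) →
      Tendsto (fun n => max 0 (min t (S n)) - partialLength (q n) (i n)) U (𝓝 0) → f t = z := by
    intro t i z hz hlim
    refine tendsto_nhds_unique (hf t) (tendsto_iff_dist_tendsto_zero.2 ?_)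
    have hlim' := hεU.add hlim.abs
    rw [abs_zero, add_zero] at hlim'
    refine squeeze_zero (fun n => dist_nonneg) (fun n => ?_) hlim'
    rw [← hz n]
    exact hgq n t (i n)
  refine ⟨T, f, hTM, hfl, hend 0 (fun _ => 0) x h0 ?_, hend T N y hN ?_, fun η hη => ?_⟩
  · simp [partialLength_zero, hS0]
  · have h1 : Tendsto (fun n => max 0 (min T (S n)) - S n) U (𝓝 (max 0 (min T T) - T)) :=
      (tendsto_const_nhds.max (tendsto_const_nhds.min hT)).sub hT
    simpa [hTM.1] using h1
  -- Convergence at the finitely many multiples of `δ` in `[0, M]` is made uniform by the Lipschitz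
  -- bounds; the errors add up to at most `4 * δ ≤ η`.
  · set δ := η / 8 with hδ
    have hδ0 : 0 < δ := by positivity
    have hnet : ∀ᶠ n in (U : Filter ℕ), ∀ k ∈ Finset.range (⌊M / δ⌋₊ + 1),
        dist (g n (k * δ)) (f (k * δ)) ≤ δ :=
      (eventually_all_finset _).2 fun k _ =>
        ((tendsto_iff_dist_tendsto_zero.1 (hf (k * δ))).eventually_le_const hδ0)
    have hSU : ∀ᶠ n in (U : Filter ℕ), |S n - T| ≤ η :=
      (tendsto_iff_dist_tendsto_zero.1 hT).eventually_le_const hη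
    refine Frequently.filter_mono (Eventually.frequently ?_) hUtop
    filter_upwards [hnet, hSU, hεU.eventually_le_const hδ0] with n hn1 hn2 hn3
    refine ⟨hn2, fun i hi => ?_⟩
    set s := partialLength (q n) i with hs
    have hs0 : 0 ≤ s := partialLength_nonneg _ _
    have hsS : s ≤ S n := monotone_partialLength _ hi
    set k := ⌊s / δ⌋₊ with hk
    have hk1 : (k : ℝ) * δ ≤ s := (le_div_iff₀ hδ0).1 (Nat.floor_le (by positivity))
    have hk2 : s < (k + 1) * δ := (div_lt_iff₀ hδ0).1 (Nat.lt_floor_add_one _)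
    have hkM : k ∈ Finset.range (⌊M / δ⌋₊ + 1) := by
      rw [Finset.mem_range, Nat.lt_succ_iff]
      exact Nat.floor_le_floor (div_le_div_of_nonneg_right (hsS.trans (hM n)) hδ0.le)
    have hkδ : (0 : ℝ) ≤ k * δ := by positivity
    have e1 : dist (f s) (f (k * δ)) ≤ δ := by
      refine (hfl.dist_le_mul _ _).trans ?_
      rw [NNReal.coe_one, one_mul, Real.dist_eq, abs_of_nonneg (by linarith)]
      linarith
    have e2 := hn1 k hkM
    rw [dist_comm] at e2
    have e3 : dist (g n (k * δ)) (q n i) ≤ δ + δ := by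
      refine (hgq n _ i).trans (add_le_add hn3 ?_)
      rw [min_eq_left (hk1.trans hsS), max_eq_right hkδ, abs_sub_comm, abs_of_nonneg (by linarith)]
      linarith
    have e4 := dist_triangle4 (f s) (f (k * δ)) (g n (k * δ)) (q n i)
    linarith

end ChainModulus

namespace ChainModulus

variable {X : Type*} [MetricSpace X]

/-! ### Lower semicontinuity of the integral -/

/-- The chain integral of a real function. -/
noncomputable def realChainIntegral (v : X → ℝ) (N : ℕ) (q : ℕ → X) : ℝ :=
  ∑ i ∈ Finset.range N, (v (q i) + v (q (i + 1))) / 2 * dist (q i) (q (i + 1))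

theorem Chain.integral_ofSeq_coe (N : ℕ) (q : ℕ → X) (u : X → ℝ≥0) :
    (Chain.ofSeq N q).integral (fun z => u z) =
      ENNReal.ofReal (realChainIntegral (fun z => u z) N q) := by
  rw [Chain.integral_ofSeq, realChainIntegral, ENNReal.ofReal_sum_of_nonneg]
  · refine Finset.sum_congr rfl fun i _ => ?_
    rw [ENNReal.ofReal_mul (by positivity), ENNReal.ofReal_div_of_pos two_pos,
      ENNReal.ofReal_add (by positivity) (by positivity)]
    simp
  · intro i _
    positivity

theorem mul_partialLength_le_realChainIntegral {v : X → ℝ} {σ : ℝ} (hσ : ∀ z, σ ≤ v z) (N : ℕ)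
    (q : ℕ → X) : σ * partialLength q N ≤ realChainIntegral v N q := by
  rw [partialLength, Finset.mul_sum]
  refine Finset.sum_le_sum fun i _ => mul_le_mul_of_nonneg_right ?_ dist_nonneg
  linarith [hσ (q i), hσ (q (i + 1))]

/-- While the parameter runs between the `i`-th and the next partial length, `f` stays within `2 *
η` of `q i`. Replacing `v (q i)` by the mean of the two vertex values costs another `K * η / 2`, so
`3 * K * η` suffices. -/
theorem integral_comp_le_realChainIntegral_add {v : X → ℝ} {K : ℝ≥0} (hv : LipschitzWith K v)
    {f : ℝ → X} (hf : LipschitzWith 1 f) {N : ℕ} {q : ℕ → X} {η : ℝ}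
    (hq : ∀ i < N, dist (q i) (q (i + 1)) ≤ η)
    (hfq : ∀ i ≤ N, dist (f (partialLength q i)) (q i) ≤ η) :
    ∫ t in (0 : ℝ)..partialLength q N, v (f t) ≤
      realChainIntegral v N q + 3 * K * η * partialLength q N := by
  have hcont : Continuous fun t => v (f t) := hv.continuous.comp hf.continuous
  have hvle : ∀ z w, v z ≤ v w + K * dist z w := fun z w => hv.le_add_mul z w
  rw [← partialLength_zero q, ← intervalIntegral.sum_integral_adjacent_intervals
    (f := fun t => v (f t)) (a := partialLength q) fun k _ => hcont.intervalIntegrable _ _]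
  have hstep : ∀ i ∈ Finset.range N,
      ∫ t in partialLength q i..partialLength q (i + 1), v (f t) ≤
        (v (q i) + v (q (i + 1))) / 2 * dist (q i) (q (i + 1)) +
          3 * K * η * dist (q i) (q (i + 1)) := by
    intro i hi
    have hiN := Finset.mem_range.1 hi
    have hle : partialLength q i ≤ partialLength q (i + 1) := monotone_partialLength q i.le_succ
    have hd := hq i hiN
    have hη : 0 ≤ η := dist_nonneg.trans hd
    have hK : (0 : ℝ) ≤ K := K.2
    have hb : ∀ t ∈ Icc (partialLength q i) (partialLength q (i + 1)),
        v (f t) ≤ (v (q i) + v (q (i + 1))) / 2 + 3 * K * η := by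
      rintro t ⟨ht1, ht2⟩
      rw [partialLength_succ] at ht2
      have h1 : dist (f t) (f (partialLength q i)) ≤ η := by
        refine (hf.dist_le_mul _ _).trans ?_
        rw [NNReal.coe_one, one_mul, Real.dist_eq, abs_of_nonneg (by linarith)]
        linarith
      have h2 := (dist_triangle (f t) _ _).trans (add_le_add h1 (hfq i hiN.le))
      have h3 := (hvle (f t) (q i)).trans (add_le_add_right (mul_le_mul_of_nonneg_left h2 hK) _)
      have h4 := (hvle (q i) (q (i + 1))).trans
        (add_le_add_right (mul_le_mul_of_nonneg_left hd hK) _)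
      have h5 : 0 ≤ K * η := by positivity
      linarith
    refine (intervalIntegral.integral_mono_on hle (hcont.intervalIntegrable _ _)
      intervalIntegrable_const hb).trans (le_of_eq ?_)
    rw [intervalIntegral.integral_const, partialLength_succ, smul_eq_mul]
    ring
  refine (Finset.sum_le_sum hstep).trans (le_of_eq ?_)
  rw [Finset.sum_add_distrib, ← Finset.mul_sum, realChainIntegral, partialLength]

/-- Up to `O(η)` the integral along `f` is bounded by a chain integral; changing the upper limit
from `S` to `T` costs at most `B * η`, with `B` a bound for `v ∘ f` on `[0, M]`. -/
theorem integral_comp_le_of_frequently {v : X → ℝ} {K : ℝ≥0} (hv : LipschitzWith K v)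
    {f : ℝ → X} (hf : LipschitzWith 1 f) {N : ℕ → ℕ} {q : ℕ → ℕ → X} {ε : ℕ → ℝ} {M T A : ℝ}
    (hT : T ∈ Icc 0 M)
    (hε : Tendsto ε atTop (𝓝 0)) (hq : ∀ n, ∀ i < N n, dist (q n i) (q n (i + 1)) ≤ ε n)
    (hM : ∀ n, partialLength (q n) (N n) ≤ M)
    (hfq : ∀ η > 0, ∃ᶠ n in atTop, |partialLength (q n) (N n) - T| ≤ η ∧
        ∀ j ≤ N n, dist (f (partialLength (q n) j)) (q n j) ≤ η)
    (hA : ∀ᶠ n in atTop, realChainIntegral v (N n) (q n) ≤ A) :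
    ∫ t in (0 : ℝ)..T, v (f t) ≤ A := by
  have hcont : Continuous fun t => v (f t) := hv.continuous.comp hf.continuous
  have hK : (0 : ℝ) ≤ K := K.2
  have hM0 : 0 ≤ M := hT.1.trans hT.2
  obtain ⟨B, hB⟩ : ∃ B, ∀ t ∈ Icc 0 M, ‖v (f t)‖ ≤ B :=
    isCompact_Icc.exists_bound_of_continuousOn hcont.continuousOn
  have key : ∀ η > 0, ∫ t in (0 : ℝ)..T, v (f t) ≤ A + (3 * K * M + B) * η := by
    intro η hη
    obtain ⟨n, ⟨hn1, hn2⟩, hn3, hn4⟩ :=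
      ((hfq η hη).and_eventually ((hε.eventually_le_const hη).and hA)).exists
    set S := partialLength (q n) (N n) with hS
    have hS0 : 0 ≤ S := partialLength_nonneg _ _
    have h1 := integral_comp_le_realChainIntegral_add hv hf
      (fun i hi => (hq n i hi).trans hn3) hn2
    have h2 : ∫ t in S..T, v (f t) ≤ B * η := by
      refine (le_abs_self _).trans ?_
      rw [← Real.norm_eq_abs]
      have hB0 : 0 ≤ B := (norm_nonneg _).trans (hB 0 ⟨le_rfl, hM0⟩)
      refine (intervalIntegral.norm_integral_le_of_norm_le_const (C := B) fun t ht => ?_).trans ?_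
      · have ht' := uIoc_subset_uIcc ht
        exact hB t (uIcc_subset_Icc ⟨hS0, hM n⟩ hT ht')
      · rw [abs_sub_comm]
        exact mul_le_mul_of_nonneg_left hn1 hB0
    have h3 : 3 * K * η * S ≤ 3 * K * η * M := mul_le_mul_of_nonneg_left (hM n) (by positivity)
    rw [← intervalIntegral.integral_add_adjacent_intervals (hcont.intervalIntegrable 0 S)
      (hcont.intervalIntegrable S T)]
    linarith
  have hlim : Tendsto (fun η : ℝ => A + (3 * K * M + B) * η) (𝓝[>] 0) (𝓝 A) := by
    have : Continuous fun η : ℝ => A + (3 * K * M + B) * η := by fun_prop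
    simpa using (this.tendsto 0).mono_left nhdsWithin_le_nhds
  exact ge_of_tendsto hlim (eventually_mem_nhdsWithin.mono key)

/-- The bound `σ` controls the lengths of the chains and yields a limit curve. For fixed `k` and `n
≥ k`, monotonicity bounds the integral of `u k` over the `n`-th chain by `1`; this passes to the
curve, and monotone convergence in `k` concludes. -/
theorem exists_curve_integral_iSup_le_one [ProperSpace X] [MeasurableSpace X] [BorelSpace X]
    {x y : X} (hxy : x ≠ y) {u : ℕ → X → ℝ≥0} (hmono : ∀ z, Monotone fun n => u n z) {K : ℕ → ℝ≥0}
    (hlip : ∀ n, LipschitzWith (K n) (u n)) {σ : ℝ≥0} (hσ0 : 0 < σ) (hσ : ∀ n z, σ ≤ u n z)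
    {c : ℕ → Chain X} (hc : ∀ n : ℕ, c n ∈ chainsBetween x y ∩ epsChains X (1 / ((n : ℝ) + 1)))
    (hcu : ∀ n, (c n).integral (fun z => u n z) ≤ 1) :
    ∃ γ ∈ curvesBetween x y, γ.integral (fun z => ⨆ n, (u n z : ℝ≥0∞)) ≤ 1 := by
  choose N q hNq using fun n => (c n).exists_eq_ofSeq
  have hends : ∀ n, q n 0 = x ∧ q n (N n) = y := fun n =>
    Chain.ofSeq_mem_chainsBetween.1 (hNq n ▸ (hc n).1)
  have hq : ∀ n, ∀ i < N n, dist (q n i) (q n (i + 1)) ≤ 1 / ((n : ℝ) + 1) := fun n =>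
    Chain.ofSeq_mem_epsChains.1 (hNq n ▸ (hc n).2)
  have hint : ∀ n, realChainIntegral (fun z => u n z) (N n) (q n) ≤ 1 := by
    intro n
    have := hcu n
    rwa [hNq, Chain.integral_ofSeq_coe, ENNReal.ofReal_le_one] at this
  have hM : ∀ n, partialLength (q n) (N n) ≤ 1 / σ := by
    intro n
    rw [le_div_iff₀' (NNReal.coe_pos.2 hσ0)]
    exact (mul_partialLength_le_realChainIntegral
      (fun z => NNReal.coe_le_coe.2 (hσ n z)) _ _).trans (hint n)
  obtain ⟨T, f, hT, hf, hf0, hfT, hfreq⟩ := exists_lipschitz_limit (fun n => (hends n).1)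
    (fun n => (hends n).2) (fun n => by positivity) tendsto_one_div_add_atTop_nhds_zero_nat hq hM
  have hT0 : 0 < T := by
    refine lt_of_le_of_ne hT.1 fun h => hxy ?_
    rw [← hf0, ← hfT, ← h]
  refine ⟨Curve.ofLipschitz hf hT0, ⟨Curve.rectifiable_ofLipschitz hf hT0, hf0, hfT⟩, ?_⟩
  have hmeas : ∀ n, Measurable fun z => (u n z : ℝ≥0∞) := fun n =>
    (hlip n).continuous.measurable.coe_nnreal_ennreal
  refine (Curve.integral_ofLipschitz_le hf hT0 (Measurable.iSup hmeas)).trans ?_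
  rw [lintegral_iSup (f := fun n t => (u n (f t) : ℝ≥0∞))
    (fun n => (hmeas n).comp hf.continuous.measurable)
    fun n k hnk t => ENNReal.coe_le_coe.2 (hmono _ hnk)]
  refine iSup_le fun k => ?_
  have hk : LipschitzWith (K k) fun z => (u k z : ℝ) := hlip k
  have hreal : ∫ t in (0 : ℝ)..T, (u k (f t) : ℝ) ≤ 1 := by
    refine integral_comp_le_of_frequently hk hf hT tendsto_one_div_add_atTop_nhds_zero_nat hq hM
      hfreq ?_
    filter_upwards [eventually_ge_atTop k] with n hn
    refine le_trans (Finset.sum_le_sum fun i _ => ?_) (hint n)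
    have h1 : (u k (q n i) : ℝ) ≤ u n (q n i) := hmono _ hn
    have h2 : (u k (q n (i + 1)) : ℝ) ≤ u n (q n (i + 1)) := hmono _ hn
    gcongr
  have hcont : Continuous fun t => (u k (f t) : ℝ) := hk.continuous.comp hf.continuous
  rw [intervalIntegral.integral_of_le hT.1, ← integral_Icc_eq_integral_Ioc] at hreal
  have hI : IntegrableOn (fun t => (u k (f t) : ℝ)) (Icc 0 T) :=
    hcont.continuousOn.integrableOn_compact isCompact_Icc
  have h := ofReal_integral_eq_lintegral_ofReal hI
    (Eventually.of_forall fun t => NNReal.coe_nonneg _)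
  simp only [ENNReal.ofReal_coe_nnreal] at h
  rw [← h]
  exact ENNReal.ofReal_le_one.2 hreal

/-! ### Lipschitz approximation of lower semicontinuous functions -/

/-- The inf-convolution of `min g n` with `n` times the distance. -/
noncomputable def lipApprox (g : X → ℝ≥0∞) (n : ℕ) (z : X) : ℝ≥0∞ :=
  ⨅ w, min (g w) n + n * edist z w

theorem lipApprox_le (g : X → ℝ≥0∞) (n : ℕ) (z : X) : lipApprox g n z ≤ min (g z) n :=
  (iInf_le _ z).trans (by simp)

/-- The truncation at `n` keeps the inf-convolution finite even when `g` is identically `∞`. -/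
theorem lipApprox_ne_top (g : X → ℝ≥0∞) (n : ℕ) (z : X) : lipApprox g n z ≠ ∞ :=
  ne_top_of_le_ne_top (ENNReal.natCast_ne_top n) ((lipApprox_le g n z).trans (min_le_right _ _))

theorem monotone_lipApprox (g : X → ℝ≥0∞) (z : X) : Monotone fun n => lipApprox g n z := by
  intro n k hnk
  have h : (n : ℝ≥0∞) ≤ k := Nat.cast_le.2 hnk
  exact iInf_mono fun w => add_le_add (min_le_min_left _ h) (mul_le_mul_left h _)

theorem lipApprox_le_add (g : X → ℝ≥0∞) (n : ℕ) (z z' : X) :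
    lipApprox g n z ≤ lipApprox g n z' + n * edist z z' := by
  rw [lipApprox, lipApprox, ENNReal.iInf_add]
  refine iInf_mono fun w => ?_
  rw [add_assoc, ← mul_add]
  refine add_le_add_right (mul_le_mul_right ?_ _) _
  rw [add_comm]
  exact edist_triangle _ _ _

theorem lipschitzWith_toNNReal_lipApprox (g : X → ℝ≥0∞) (n : ℕ) :
    LipschitzWith n fun z => (lipApprox g n z).toNNReal := by
  have h : LipschitzWith n fun z => (lipApprox g n z).toReal := by
    refine LipschitzWith.of_le_add_mul _ fun z w => ?_
    have h1 := ENNReal.toReal_mono (ENNReal.add_ne_top.2 ⟨lipApprox_ne_top g n w,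
      ENNReal.mul_ne_top (ENNReal.natCast_ne_top n) (edist_ne_top z w)⟩) (lipApprox_le_add g n z w)
    rw [ENNReal.toReal_add (lipApprox_ne_top g n w) (ENNReal.mul_ne_top
      (ENNReal.natCast_ne_top n) (edist_ne_top z w)), ENNReal.toReal_mul, ← dist_edist] at h1
    simpa using h1
  exact h

/-- For `b < g z`, lower semicontinuity gives `g > b` on a ball of radius `r` around `z`; outside it
the penalty `n * r` exceeds `b` for large `n`. -/
theorem iSup_lipApprox {g : X → ℝ≥0∞} (hg : LowerSemicontinuous g) (z : X) :
    ⨆ n, lipApprox g n z = g z := by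
  refine le_antisymm (iSup_le fun n => (lipApprox_le g n z).trans (min_le_left _ _)) ?_
  refine le_of_forall_lt fun a ha => ?_
  obtain ⟨b, hab, hb⟩ := exists_between ha
  refine hab.trans_le ?_
  obtain ⟨r, hr, hball⟩ := Metric.eventually_nhds_iff_ball.1 (hg z b hb)
  have hbt : b ≠ ∞ := (hb.trans_le le_top).ne
  have hr' : ENNReal.ofReal r ≠ 0 := by simpa using hr
  obtain ⟨n, hn⟩ := ENNReal.exists_nat_gt (r := max b (b / ENNReal.ofReal r))
    (max_lt hbt.lt_top (ENNReal.div_lt_top hbt hr')).ne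
  refine le_trans ?_ (le_iSup _ n)
  refine le_iInf fun w => ?_
  rcases lt_or_ge (dist w z) r with h | h
  · refine le_trans ?_ le_self_add
    exact le_min (hball w h).le ((le_max_left _ _).trans hn.le)
  · refine le_trans ?_ le_add_self
    have h1 : ENNReal.ofReal r ≤ edist z w := by
      rw [edist_comm, edist_dist]
      exact ENNReal.ofReal_le_ofReal h
    calc b = b / ENNReal.ofReal r * ENNReal.ofReal r :=
          (ENNReal.div_mul_cancel hr' ENNReal.ofReal_ne_top).symm
      _ ≤ n * edist z w := mul_le_mul' ((le_max_right _ _).trans hn.le) h1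

end ChainModulus

namespace ChainModulus

variable {X : Type*} [MetricSpace X] [MeasurableSpace X]

/-! ### From curves to chains -/

/-- The compactness step. The constant `σ` both bounds the lengths of the bad chains and makes the
final contradiction strict: the limit curve would satisfy `1 + σ * ℓ ≤ 1` with `ℓ ≥ d(x,y) > 0`. -/
theorem exists_lipschitz_mem_chainAdm [ProperSpace X] [BorelSpace X] {x y : X} (hxy : x ≠ y)
    {g : X → ℝ≥0∞} (hg : LowerSemicontinuous g) (hadm : g ∈ curveAdm (curvesBetween x y))
    {σ : ℝ≥0} (hσ : 0 < σ) :
    ∃ ε > 0, ∃ ρ ∈ chainAdm ε (chainsBetween x y) ∩ lipschitzFunctions X, ∀ z, ρ z ≤ g z + σ := by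
  set u : ℕ → X → ℝ≥0 := fun n z => (lipApprox g n z).toNNReal + σ with hu
  have hucoe : ∀ n z, (u n z : ℝ≥0∞) = lipApprox g n z + σ := fun n z => by
    rw [hu, ENNReal.coe_add, ENNReal.coe_toNNReal (lipApprox_ne_top g n z)]
  have hlip : ∀ n : ℕ, LipschitzWith n (u n) := fun n =>
    LipschitzWith.of_dist_le_mul fun z w => by
      have h := (lipschitzWith_toNNReal_lipApprox g n).dist_le_mul z w
      rw [NNReal.dist_eq] at h ⊢
      simpa only [hu, NNReal.coe_add, add_sub_add_right_eq_sub] using h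
  have hmeas : ∀ n, Measurable fun z => (u n z : ℝ≥0∞) := fun n =>
    (hlip n).continuous.measurable.coe_nnreal_ennreal
  by_contra! hcon
  have hex : ∀ n : ℕ, ∃ c ∈ chainsBetween x y ∩ epsChains X (1 / ((n : ℝ) + 1)),
      c.integral (fun z => u n z) ≤ 1 := by
    intro n
    by_contra! hn
    obtain ⟨z, hz⟩ := hcon (1 / ((n : ℝ) + 1)) (by positivity) (fun z => u n z)
      ⟨⟨hmeas n, fun c hc => (hn c hc).le⟩, ⟨u n, n, hlip n, fun _ => rfl⟩⟩
    rw [hucoe] at hz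
    exact absurd hz (not_lt.2 (add_le_add_left ((lipApprox_le g n z).trans (min_le_left _ _)) _))
  choose c hc hcu using hex
  have hmono : ∀ z, Monotone fun n => u n z := fun z n k hnk =>
    add_le_add_left (ENNReal.toNNReal_mono (lipApprox_ne_top g k z)
      (monotone_lipApprox g z hnk)) _
  obtain ⟨γ, ⟨hγ, hγx, hγy⟩, hint⟩ := exists_curve_integral_iSup_le_one hxy hmono hlip hσ
    (fun n z => le_add_self) hc hcu
  have hsup : (fun z => ⨆ n, (u n z : ℝ≥0∞)) = fun z => g z + σ := by
    funext z
    simp only [hucoe]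
    rw [← ENNReal.iSup_add, iSup_lipApprox hg]
  rw [hsup, Curve.integral, lintegral_add_right _ measurable_const, setLIntegral_const,
    Real.volume_Icc, sub_zero] at hint
  have h1 : 1 ≤ γ.integral g := hadm γ ⟨hγ, hγx, hγy⟩
  have hlen := hγ.dist_le_length
  rw [hγx, hγy] at hlen
  have h2 : (0 : ℝ≥0∞) < σ * ENNReal.ofReal γ.length.toReal :=
    ENNReal.mul_pos (ENNReal.coe_ne_zero.2 hσ.ne')
      (ENNReal.ofReal_pos.2 ((dist_pos.2 hxy).trans_le hlen)).ne'
  exact absurd ((add_le_add_left h1 _).trans hint)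
    (not_le.2 (ENNReal.lt_add_right ENNReal.one_ne_top h2.ne'))

/-- Minkowski's inequality in `L^p`, raised to the power `p`. -/
theorem lintegral_add_const_rpow_le {Y : Type*} [MeasurableSpace Y] {μ : Measure Y} {p : ℝ}
    (hp : 1 ≤ p) {g : Y → ℝ≥0∞}
    (hg : Measurable g) (σ : ℝ≥0∞) :
    ∫⁻ z, (g z + σ) ^ p ∂μ ≤
      ((∫⁻ z, g z ^ p ∂μ) ^ (1 / p) + σ * μ univ ^ (1 / p)) ^ p := by
  have hp0 : 0 < p := zero_lt_one.trans_le hp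
  have h := ENNReal.lintegral_Lp_add_le (μ := μ) hg.aemeasurable
    (measurable_const (a := σ)).aemeasurable hp
  rw [lintegral_const, ENNReal.mul_rpow_of_nonneg _ _ (by positivity), ← ENNReal.rpow_mul,
    mul_one_div_cancel hp0.ne', ENNReal.rpow_one] at h
  have h' := ENNReal.rpow_le_rpow h hp0.le
  rwa [← ENNReal.rpow_mul, one_div_mul_cancel hp0.ne', ENNReal.rpow_one] at h'

theorem exists_chainModulus_lipschitz_lt [ProperSpace X] [BorelSpace X] {x y : X} (hxy : x ≠ y)
    (μ : Measure X) [IsFiniteMeasure μ] {p : ℝ} (hp : 1 ≤ p) {b : ℝ≥0∞}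
    (hb : curveModulus p (curvesBetween x y) μ < b) :
    ∃ ε > 0, chainModulus ε p (chainsBetween x y) (lipschitzFunctions X) μ < b := by
  have hp0 : 0 < p := zero_lt_one.trans_le hp
  simp only [curveModulus, iInf_lt_iff, exists_prop] at hb
  obtain ⟨ρ, ⟨hρadm, hρm⟩, hρb⟩ := hb
  obtain ⟨J, hJ, hJb⟩ := exists_between hρb
  -- Vitali–Carathéodory is applied to `ρ ^ p`, with the gap up to `J` as the allowed error; the
  -- `p`-th root of `G` is still lower semicontinuous and dominates `ρ`.
  obtain ⟨G, hρG, hG, hGJ⟩ := exists_le_lowerSemicontinuous_lintegral_ge μ (fun z => ρ z ^ p)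
    (hρm.pow_const p) (tsub_pos_of_lt hJ).ne'
  rw [add_tsub_cancel_of_le hJ.le] at hGJ
  set g : X → ℝ≥0∞ := fun z => G z ^ (1 / p) with hgdef
  have hglsc : LowerSemicontinuous g :=
    ENNReal.continuous_rpow_const.comp_lowerSemicontinuous hG
      (ENNReal.monotone_rpow_of_nonneg (by positivity))
  have hgp : ∀ z, g z ^ p = G z := fun z => by
    rw [hgdef, ← ENNReal.rpow_mul, one_div_mul_cancel hp0.ne', ENNReal.rpow_one]
  have hρg : ∀ z, ρ z ≤ g z := fun z => by
    rw [hgdef, one_div]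
    exact (ENNReal.le_rpow_inv_iff hp0).2 (hρG z)
  have hgadm : g ∈ curveAdm (curvesBetween x y) := fun γ hγ =>
    (hρadm γ hγ).trans (lintegral_mono fun t => hρg _)
  have hlim : Tendsto (fun σ : ℝ≥0 => (J ^ (1 / p) + σ * μ univ ^ (1 / p)) ^ p) (𝓝[>] 0)
      (𝓝 J) := by
    have h1 : Tendsto (fun σ : ℝ≥0 => (σ : ℝ≥0∞)) (𝓝[>] 0) (𝓝 0) :=
      (ENNReal.continuous_coe.tendsto' 0 0 rfl).mono_left nhdsWithin_le_nhds
    -- Finiteness of the total mass is what lets the cost of adding `σ` tend to zero.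
    have hμ : μ univ ^ (1 / p) ≠ ∞ :=
      ENNReal.rpow_ne_top_of_nonneg (by positivity) (measure_ne_top μ univ)
    have h2 := ENNReal.Tendsto.mul_const h1 (Or.inr hμ)
    have h3 := (ENNReal.continuous_rpow_const (y := p)).continuousAt.tendsto.comp
      ((tendsto_const_nhds (x := J ^ (1 / p))).add h2)
    rwa [zero_mul, add_zero, ← ENNReal.rpow_mul, one_div_mul_cancel hp0.ne',
      ENNReal.rpow_one] at h3
  obtain ⟨σ, hσb, hσ⟩ := ((hlim.eventually_lt_const hJb).and self_mem_nhdsWithin).exists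
  obtain ⟨ε, hε, v, hv, hvg⟩ := exists_lipschitz_mem_chainAdm hxy hglsc hgadm hσ
  refine ⟨ε, hε, lt_of_le_of_lt (iInf₂_le v hv) (lt_of_le_of_lt ?_ hσb)⟩
  calc ∫⁻ z, v z ^ p ∂μ ≤ ∫⁻ z, (g z + σ) ^ p ∂μ :=
        lintegral_mono fun z => ENNReal.rpow_le_rpow (hvg z) hp0.le
    _ ≤ ((∫⁻ z, g z ^ p ∂μ) ^ (1 / p) + σ * μ univ ^ (1 / p)) ^ p :=
        lintegral_add_const_rpow_le hp hglsc.measurable _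
    _ ≤ (J ^ (1 / p) + σ * μ univ ^ (1 / p)) ^ p := by
        simp only [hgp]
        gcongr

/-! ### Passage to the limit -/

theorem chainModulus_mono {ε ε' p : ℝ} (hε : ε ≤ ε') (C : Set (Chain X)) (F : Set (X → ℝ≥0∞))
    (μ : Measure X) : chainModulus ε p C F μ ≤ chainModulus ε' p C F μ :=
  biInf_mono fun _ hρ => ⟨⟨hρ.1.1, fun c hc => hρ.1.2 c ⟨hc.1, fun i => (hc.2 i).trans hε⟩⟩, hρ.2⟩

theorem chainModulus_borelFiniteAt_le [BorelSpace X] {ε p : ℝ} (x y : X) (C : Set (Chain X))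
    (μ : Measure X) :
    chainModulus ε p C (borelFiniteAt x y) μ ≤ chainModulus ε p C (lipschitzFunctions X) μ := by
  refine biInf_mono fun ρ hρ => ⟨hρ.1, hρ.1.1, ?_⟩
  obtain ⟨u, K, -, hu⟩ := hρ.2
  rw [hu, hu]
  exact ⟨ENNReal.coe_lt_top, ENNReal.coe_lt_top⟩

/-- The constant curve has length zero, so no function is admissible. -/
theorem curveModulus_self_eq_top (p : ℝ) (x : X) (μ : Measure X) :
    curveModulus p (curvesBetween x x) μ = ∞ := by
  have hconst : LipschitzWith 1 fun _ : ℝ => x := LipschitzWith.const' x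
  set γ := Curve.ofLipschitz hconst one_pos
  have hlen : γ.length = 0 := eVariationOn.constant_on
    (Subsingleton.anti subsingleton_singleton (image_subset_iff.2 fun _ _ => rfl))
  refine iInf₂_eq_top.2 fun ρ hρ => ?_
  have h := hρ.1 γ ⟨Curve.rectifiable_ofLipschitz hconst one_pos, rfl, rfl⟩
  simp [Curve.integral, hlen] at h

end ChainModulus

theorem mainTheorem10 {X : Type*} [MetricSpace X] [TopologicalSpace.SeparableSpace X]
    [CompleteSpace X] [MeasurableSpace X] [BorelSpace X] (m : Measure X)
    (hm : ChainModulus.IsMetricMeasure m) (hd : ChainModulus.IsDoubling m)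
    (p : ℝ) (hp : 1 ≤ p) (L : ℝ) (hL : 1 ≤ L) (x y : X) :
    Tendsto
        (fun ε : ℝ => ChainModulus.chainModulus ε p (ChainModulus.chainsBetween x y)
          (ChainModulus.borelFiniteAt x y) (ChainModulus.rieszMeasure m L x y))
        (𝓝[>] 0)
        (𝓝 (ChainModulus.curveModulus p (ChainModulus.curvesBetween x y)
          (ChainModulus.rieszMeasure m L x y))) ∧
      Tendsto
        (fun ε : ℝ => ChainModulus.chainModulus ε p (ChainModulus.chainsBetween x y)
          (ChainModulus.lipschitzFunctions X) (ChainModulus.rieszMeasure m L x y))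
        (𝓝[>] 0)
        (𝓝 (ChainModulus.curveModulus p (ChainModulus.curvesBetween x y)
          (ChainModulus.rieszMeasure m L x y))) := by
  set μ := ChainModulus.rieszMeasure m L x y
  set mod := ChainModulus.curveModulus p (ChainModulus.curvesBetween x y) μ with hmod
  have hlow : ∀ ε > 0, mod ≤ ChainModulus.chainModulus ε p (ChainModulus.chainsBetween x y)
      (ChainModulus.borelFiniteAt x y) μ := fun ε hε =>
    ChainModulus.curveModulus_le_chainModulus hε p μ
  have hupp : ∀ b > mod, ∃ ε > 0, ChainModulus.chainModulus ε p (ChainModulus.chainsBetween x y)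
      (ChainModulus.lipschitzFunctions X) μ < b := by
    intro b hb
    -- For coinciding poles the curve modulus is `∞`, and no `b` lies above it.
    rcases eq_or_ne x y with rfl | hxy
    · rw [hmod, ChainModulus.curveModulus_self_eq_top] at hb
      exact absurd hb not_top_lt
    · have := hd.properSpace hm
      have := hd.isFiniteMeasure_rieszMeasure hL hxy
      exact ChainModulus.exists_chainModulus_lipschitz_lt hxy μ hp hb
  have hle := fun ε => ChainModulus.chainModulus_borelFiniteAt_le (ε := ε) (p := p) x y
    (ChainModulus.chainsBetween x y) μ
  refine ⟨tendsto_order.2 ⟨fun a ha => ?_, fun b hb => ?_⟩,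
    tendsto_order.2 ⟨fun a ha => ?_, fun b hb => ?_⟩⟩
  · filter_upwards [self_mem_nhdsWithin] with ε hε using ha.trans_le (hlow ε hε)
  · obtain ⟨ε₀, hε₀, hlt⟩ := hupp b hb
    filter_upwards [Ioc_mem_nhdsGT hε₀] with ε hε
    exact ((hle ε).trans (ChainModulus.chainModulus_mono hε.2 _ _ _)).trans_lt hlt
  · filter_upwards [self_mem_nhdsWithin] with ε hε using
      (ha.trans_le (hlow ε hε)).trans_le (hle ε)
  · obtain ⟨ε₀, hε₀, hlt⟩ := hupp b hb
    filter_upwards [Ioc_mem_nhdsGT hε₀] with ε hε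
    exact (ChainModulus.chainModulus_mono hε.2 _ _ _).trans_lt hlt
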